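/- Let $S$ be a finite left regular band with identity, i.e. a finite monoid with $x^2=x$ and $xyx=xy$ for all $x,y\in S$, and let $k$ be any field. Define a partial order on $S$ by $y\le x \iff yx=x$ (with $y<x$ meaning $y\le x$ and $y\ne x$), and a preorder by $y\preceq x\iff xy=x$. The support lattice $L$ is the poset obtained from $(S,\preceq)$ by identifying $x$ and $y$ when $x\preceq y$ and $y\preceq x$; write $\operatorname{supp}:S\to L$ for the quotient map and $S_X=\{x\in S:\operatorname{supp}(x)=X\}$ for $X\in L$. Let $M_X$ be the one-dimensional $kS$-module $k$ on which $y\in S$ acts as $1$ if $\operatorname{supp}(y)\le X$ and as $0$ otherwise. For $X,Y\in L$ define $a_{XY}$ as follows. If $Y\not\le X$, then $a_{XY}=0$. If $Y\le X$, fix $y\in S$ with $\operatorname{supp}(y)=Y$; for $x,x'\in S_X$ write $x\smile x'$ if $yx=yx'$ or there is $w\in S$ with $y<w$, $w<yx$ and $w<yx'$; let $\sim$ be the transitive closure of $\smile$ (an equivalence relation on $S_X$), and let $a_{XY}$ be the number of $\sim$-classes on $S_X$ minus one. The $\operatorname{Ext}$-quiver of a $k$-algebra $A$ whose simple modules are all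 one-dimensional has as vertices the isomorphism classes of simple $A$-modules, and $\dim_k\operatorname{Ext}^1_A(M,N)$ arrows from the class of $M$ to the class of $N$. Then, whichever elements $y$ are chosen, the $\operatorname{Ext}$-quiver of the semigroup algebra $kS$ has vertex set $L$ (that is, $X\mapsto M_X$ induces a bijection from $L$ onto the isomorphism classes of simple $kS$-modules), and it has exactly $a_{XY}$ arrows from $X$ to $Y$ for all $X,Y\in L$. Equivalently, $\dim_k\operatorname{Ext}^1_{kS}(M_X,M_Y)=a_{XY}$ for all $X,Y\in L$. -/

import Mathlib

open CategoryTheory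

universe u v w

noncomputable section

/-- A left regular band: a semigroup with `x² = x` and `xyx = xy`. -/
class LeftRegularBand (S : Type u) [Semigroup S] : Prop where
  mul_self : ∀ x : S, x * x = x
  mul_mul_left : ∀ x y : S, x * y * x = x * y

namespace LeftRegularBand

section Support

variable (S : Type u) [Semigroup S] [LeftRegularBand S]

/-- The preorder `y ≼ x ↔ xy = x` on a left regular band. -/
abbrev supportPreorder : Preorder S where
  le y x := x * y = x
  le_refl x := mul_self x
  le_trans a b c hab hbc :=
    calc c * a = c * b * a := by rw [show c * b = c from hbc]
      _ = c * (b * a) := mul_assoc _ _ _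
      _ = c := by rw [show b * a = b from hab, show c * b = c from hbc]

/-- The support (semi)lattice `L` of `S`: the poset obtained from the preorder `≼` by
identifying `x` and `y` whenever `x ≼ y` and `y ≼ x`. -/
def SupportLattice : Type u :=
  @Antisymmetrization S (supportPreorder S).le inferInstance

instance : PartialOrder (SupportLattice S) :=
  @instPartialOrderAntisymmetrization S (supportPreorder S)

variable {S}

/-- The support map `supp : S → L`. -/
def supp (x : S) : SupportLattice S :=
  @toAntisymmetrization S (supportPreorder S).le inferInstance x

theorem supp_le_supp {x y : S} : supp y ≤ supp x ↔ x * y = x := Iff.rfl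

theorem supp_surjective (X : SupportLattice S) : ∃ x : S, supp x = X :=
  Quotient.exists_rep X

theorem supp_mul_le {x y : S} {X : SupportLattice S} :
    supp (x * y) ≤ X ↔ supp x ≤ X ∧ supp y ≤ X := by
  obtain ⟨z, rfl⟩ := supp_surjective X
  simp only [supp_le_supp]
  constructor
  · intro h
    have hx : z * x = z := by
      calc z * x = z * (x * y) * x := by rw [h]
        _ = z * (x * y * x) := mul_assoc _ _ _
        _ = z := by rw [mul_mul_left, h]
    refine ⟨hx, ?_⟩
    calc z * y = z * x * y := by rw [hx]
      _ = z := by rw [mul_assoc, h]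
  · rintro ⟨hx, hy⟩
    rw [← mul_assoc, hx, hy]

/-- The strict part of the partial order `y ≤ x ↔ yx = x` on a left regular band. -/
def FaceLT (y x : S) : Prop := y * x = x ∧ y ≠ x

/-- The relation `x ⌣ x'` on `S_X` (the elements of support `X`), computed from `y`: either
`yx = yx'`, or there is a `w` with `y < w`, `w < yx` and `w < yx'`. -/
def Smile (y : S) (X : SupportLattice S) (x x' : {x : S // supp x = X}) : Prop :=
  y * x.1 = y * x'.1 ∨ ∃ w : S, FaceLT y w ∧ FaceLT w (y * x.1) ∧ FaceLT w (y * x'.1)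

theorem Smile.symm {y : S} {X : SupportLattice S} {x x' : {x : S // supp x = X}}
    (h : Smile y X x x') : Smile y X x' x :=
  h.imp Eq.symm fun ⟨w, h₁, h₂, h₃⟩ => ⟨w, h₁, h₃, h₂⟩

/-- The transitive closure `∼` of `⌣`. -/
def smileSetoid (y : S) (X : SupportLattice S) : Setoid {x : S // supp x = X} where
  r := Relation.TransGen (Smile y X)
  iseqv :=
    { refl := fun _ => Relation.TransGen.single (Or.inl rfl)
      symm := fun h => by
        induction h with
        | single h => exact .single h.symm
        | tail _ h ih => exact .head h.symm ih
      trans := Relation.TransGen.trans }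

open Classical in
/-- The number `a_{XY}`, computed from an element `y` of support `Y`: the number of `∼`-classes
on `S_X`, minus one, if `Y ≤ X`, and `0` otherwise. -/
def arrowNumber (X : SupportLattice S) (y : S) : ℕ :=
  if supp y ≤ X then Nat.card (Quotient (smileSetoid y X)) - 1 else 0

end Support

section SimpleModules

variable (k : Type v) [Field k] {S : Type u} [Monoid S] [LeftRegularBand S]

open Classical in
/-- The character `χ_X : kS → k`, with `χ_X(y) = 1` if `supp y ≤ X` and `χ_X(y) = 0` otherwise
for `y` in `S`. -/
def character (X : SupportLattice S) : MonoidAlgebra k S →ₐ[k] k :=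
  MonoidAlgebra.lift k k S
    { toFun := fun y => if supp y ≤ X then 1 else 0
      map_one' := by
        obtain ⟨x, rfl⟩ := supp_surjective X
        exact if_pos (supp_le_supp.2 (mul_one x))
      map_mul' := fun x y => by
        by_cases hx : supp x ≤ X <;> by_cases hy : supp y ≤ X <;> simp [supp_mul_le, hx, hy] }

/-- The one-dimensional `kS`-module `M_X`: the space `k`, on which `kS` acts through `χ_X`. -/
def charModule (X : SupportLattice S) : ModuleCat.{max u v} (MonoidAlgebra k S) :=
  (ModuleCat.restrictScalars (character k X).toRingHom).obj
    (ModuleCat.of k (ULift.{max u v} k))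

end SimpleModules

end LeftRegularBand

section ExtQuiver

variable (k : Type v) [Field k] (A : Type w) [Ring A] [Algebra k A]

/-- Isomorphism of simple `A`-modules. -/
def simpleModuleSetoid : Setoid {M : ModuleCat.{w} A // Simple M} where
  r M N := Nonempty (M.1 ≅ N.1)
  iseqv :=
    { refl := fun M => ⟨Iso.refl M.1⟩
      symm := fun ⟨f⟩ => ⟨f.symm⟩
      trans := fun ⟨f⟩ ⟨g⟩ => ⟨f ≪≫ g⟩ }

/-- The vertices of the `Ext`-quiver of a `k`-algebra `A`: the isomorphism classes of simple
`A`-modules. -/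
@[nolint unusedArguments]
def ExtQuiver (k : Type v) [Field k] (A : Type w) [Ring A] [Algebra k A] : Type (w + 1) :=
  Quotient (simpleModuleSetoid A)

variable {k A}

/-- A simple module in the isomorphism class given by a vertex of the `Ext`-quiver. -/
def ExtQuiver.rep (V : ExtQuiver k A) : ModuleCat.{w} A :=
  (Quotient.out (s := simpleModuleSetoid A) V).1

/-- The arrows `V ⟶ W` of the `Ext`-quiver of `A` are indexed by a `k`-basis of `Ext¹_A(V, W)`,
so that there are `dim_k Ext¹_A(V, W)` of them. -/
instance : Quiver (ExtQuiver k A) where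
  Hom V W := Module.Basis.ofVectorSpaceIndex k (Abelian.Ext V.rep W.rep 1)

end ExtQuiver

end

/-! For one-dimensional modules with characters χ and ψ, the presentation 0 → ker χ → A → M → 0
identifies `Ext¹(M, N)` with the (ψ, χ)-derivations modulo the multiples of ψ - χ
(`exists_skewDerivations_surjection`). For χ = χ_X and ψ = χ_Y on kS, a derivation is a function on
S with D(st) = [supp s ≤ Y] D(t) + [supp t ≤ X] D(s). Suppose Y < X. Then D vanishes on s unless
supp s ≤ X and supp s ≰ Y, and there D(s) = D(sx) for any x in S_X, so D is determined by its values
on S_X. These are constant along ⌣ (`skewDerivation_eq_of_smile`), and every function on the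
∼-classes arises (`classFunction_mem_skewDerivations`, resting on `smile_leftMul`). The multiples of
ψ - χ give the constant functions, whence the minus one. If Y = X there are no nonzero derivations;
if Y ≰ X all are multiples of ψ - χ. Every simple module is some M_X: an element of maximal support
among those not annihilating it forces kS to act by scalars. -/

noncomputable section

/-! ### Modules affording a character, and Ext¹ between them. -/

section CharacterExt

variable {k : Type v} [Field k] {A : Type w} [Ring A] [Algebra k A]

/-- `M` is one-dimensional, with `A` acting through the character `χ`. -/
def AffordsCharacter (χ : A →ₐ[k] k) (M : ModuleCat.{w} A) : Prop :=
  ∃ e : k ≃+ M, ∀ (a : A) (c : k), e (χ a * c) = a • e c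

theorem AffordsCharacter.of_iso {χ : A →ₐ[k] k} {M N : ModuleCat.{w} A}
    (h : AffordsCharacter χ M) (i : M ≅ N) : AffordsCharacter χ N := by
  obtain ⟨e, he⟩ := h
  exact ⟨e.trans i.toLinearEquiv.toAddEquiv, fun a c => by simp [he]⟩

theorem AffordsCharacter.nonempty_iso {χ : A →ₐ[k] k} {M N : ModuleCat.{w} A}
    (hM : AffordsCharacter χ M) (hN : AffordsCharacter χ N) : Nonempty (M ≅ N) := by
  obtain ⟨e, he⟩ := hM
  obtain ⟨f, hf⟩ := hN
  refine ⟨LinearEquiv.toModuleIso { e.symm.trans f with map_smul' := fun a x => ?_ }⟩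
  obtain ⟨c, rfl⟩ := e.surjective x
  simp [← he, ← hf]

theorem AffordsCharacter.character_eq {χ ψ : A →ₐ[k] k} {M : ModuleCat.{w} A}
    (h : AffordsCharacter χ M) (h' : AffordsCharacter ψ M) : χ = ψ := by
  obtain ⟨e, he⟩ := h
  obtain ⟨f, hf⟩ := h'
  ext a
  have key (φ : A →ₐ[k] k) (g : k ≃+ M) (hg : ∀ (a : A) (c : k), g (φ a * c) = a • g c)
      (x : M) : (a - algebraMap k A (φ a)) • x = 0 := by
    obtain ⟨c, rfl⟩ := g.surjective x
    rw [← hg]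
    simp
  have h₁ := key χ e he (e 1)
  have h₂ := key ψ f hf (e 1)
  have h₃ : algebraMap k A (χ a - ψ a) • e 1 = 0 := by
    rw [map_sub]
    calc _ = (a - algebraMap k A (ψ a)) • e 1 - (a - algebraMap k A (χ a)) • e 1 := by
          rw [← sub_smul]; congr 1; abel
      _ = 0 := by rw [h₁, h₂, sub_zero]
  rw [← he] at h₃
  simpa [sub_eq_zero] using h₃

theorem AffordsCharacter.simple {χ : A →ₐ[k] k} {M : ModuleCat.{w} A}
    (h : AffordsCharacter χ M) : Simple M := by
  obtain ⟨e, he⟩ := h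
  have : Nontrivial M := e.toEquiv.symm.nontrivial
  rw [simple_iff_isSimpleModule', isSimpleModule_iff_toSpanSingleton_surjective]
  refine ⟨this, fun m hm x => ?_⟩
  obtain ⟨c, rfl⟩ := e.surjective m
  obtain ⟨d, rfl⟩ := e.surjective x
  have hc : c ≠ 0 := by rintro rfl; simp at hm
  exact ⟨algebraMap k A (d / c), by simp [← he, hc]⟩

variable (χ ψ : A →ₐ[k] k)

/-- The `(ψ, χ)`-derivations of `A`: the linear forms `D` on `A` with
`D (a * b) = ψ a * D b + D a * χ b`. -/
def skewDerivations : Submodule k (A →ₗ[k] k) where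
  carrier := {D | ∀ a b, D (a * b) = ψ a * D b + D a * χ b}
  zero_mem' := by simp
  add_mem' := fun {D E} hD hE a b => by
    have hD : ∀ a b, D (a * b) = ψ a * D b + D a * χ b := hD
    have hE : ∀ a b, E (a * b) = ψ a * E b + E a * χ b := hE
    simp only [LinearMap.add_apply, hD, hE]; ring
  smul_mem' := fun c D hD a b => by
    have hD : ∀ a b, D (a * b) = ψ a * D b + D a * χ b := hD
    simp only [LinearMap.smul_apply, hD, smul_eq_mul]; ring

variable {χ ψ}

theorem mem_skewDerivations {D : A →ₗ[k] k} :
    D ∈ skewDerivations χ ψ ↔ ∀ a b, D (a * b) = ψ a * D b + D a * χ b := Iff.rfl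

theorem skewDerivations_map_one {D : A →ₗ[k] k} (hD : D ∈ skewDerivations χ ψ) : D 1 = 0 := by
  simpa using hD 1 1

variable {M N : ModuleCat.{w} A}

/-- The surjection of `A` onto a module affording the character `χ`. -/
def characterProjection (e : k ≃+ M) (he : ∀ (a : A) (c : k), e (χ a * c) = a • e c) :
    A →ₗ[A] M where
  toFun a := e (χ a)
  map_add' := by simp
  map_smul' := by simp [he]

/-- The homomorphism that a `(ψ, χ)`-derivation induces on the kernel of `χ`. -/
def skewDerivationHom (e : k ≃+ M) (he : ∀ (a : A) (c : k), e (χ a * c) = a • e c)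
    (f : k ≃+ N) (hf : ∀ (a : A) (c : k), f (ψ a * c) = a • f c)
    (D : skewDerivations χ ψ) : LinearMap.ker (characterProjection e he) →ₗ[A] N where
  toFun x := f (D.1 x)
  map_add' := by simp
  map_smul' := fun a x => by
    have hx : χ x.1 = 0 := by simpa [characterProjection] using x.2
    simp [D.2 a x, hx, hf]

/-- `Ext¹(M, N)` is the quotient of the derivations by the multiples of `ψ - χ`. -/
theorem exists_skewDerivations_surjection (hM : AffordsCharacter χ M)
    (hN : AffordsCharacter ψ N) :
    ∃ Θ : skewDerivations χ ψ →ₗ[k] Abelian.Ext M N 1, Function.Surjective Θ ∧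
      ∀ D, Θ D = 0 ↔ ∃ c : k, D.1 = c • (ψ.toLinearMap - χ.toLinearMap) := by
  obtain ⟨e, he⟩ := hM
  obtain ⟨f, hf⟩ := hN
  have hπ : Function.Surjective (characterProjection e he) := fun x => by
    refine ⟨algebraMap k A (e.symm x), ?_⟩
    simp [characterProjection]
  let S := (characterProjection e he).shortComplexKer
  have hS : S.ShortExact := LinearMap.shortExact_shortComplexKer hπ
  have : Projective S.X₂ := ModuleCat.projective_of_free (Module.Free.chooseBasis A A)
  let Φ : skewDerivations χ ψ →ₗ[k] (S.X₁ ⟶ N) :=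
    { toFun := fun D => ModuleCat.ofHom (skewDerivationHom e he f hf D)
      map_add' := fun D E => by
        ext x
        exact map_add f (D.1 x.1) (E.1 x.1)
      map_smul' := fun c D => by
        ext x
        have := hf (algebraMap k A c) (D.1 x.1)
        rw [AlgHom.commutes] at this
        exact this }
  have hΦ (D) (x : S.X₁) : (Φ D).hom x = f (D.1 x.1) := rfl
  have sub_mem (a : A) : a - algebraMap k A (χ a) ∈ LinearMap.ker (characterProjection e he) := by
    simp [characterProjection]
  refine ⟨(Abelian.Ext.precompOfLinear hS.extClass k N (add_zero 1)).comp
    ((Abelian.Ext.linearEquiv₀ (R := k)).symm.toLinearMap.comp Φ), ?_, fun D => ?_⟩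
  · intro x
    obtain ⟨y, rfl⟩ := precomp_extClass_surjective_of_projective_X₂ N hS 0 x
    obtain ⟨h, rfl⟩ := (Abelian.Ext.linearEquiv₀ (R := k)).symm.surjective y
    -- The projection of A onto ker χ along the scalars obeys a Leibniz rule, so composing it with a
    -- homomorphism on ker χ gives a derivation.
    let aug (a : A) : S.X₁ := ⟨a - algebraMap k A (χ a), sub_mem a⟩
    have aug_add (a b : A) : aug (a + b) = aug a + aug b := by
      apply Subtype.ext
      change a + b - algebraMap k A (χ (a + b)) =
        a - algebraMap k A (χ a) + (b - algebraMap k A (χ b))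
      rw [map_add, map_add]; abel
    have aug_mul (a b : A) : aug (a * b) = a • aug b + algebraMap k A (χ b) • aug a := by
      apply Subtype.ext
      change a * b - algebraMap k A (χ (a * b)) = a * (b - algebraMap k A (χ b)) +
        algebraMap k A (χ b) * (a - algebraMap k A (χ a))
      rw [Algebra.commutes (χ b), map_mul, map_mul, mul_sub, sub_mul]; abel
    have aug_smul (c : k) (a : A) : aug (c • a) = algebraMap k A c • aug a := by
      apply Subtype.ext
      change c • a - algebraMap k A (χ (c • a)) =
        algebraMap k A c * (a - algebraMap k A (χ a))
      simp [Algebra.smul_def, mul_sub]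
    have symm_smul (a : A) (n : N) : f.symm (a • n) = ψ a * f.symm n := by
      apply f.injective
      rw [hf, f.apply_symm_apply, f.apply_symm_apply]
    have aug_coe (x : S.X₁) : aug x.1 = x := by
      have hx : χ x.1 = 0 := by simpa [characterProjection] using x.2
      apply Subtype.ext
      simp [aug, hx]
    let D : A →ₗ[k] k :=
      { toFun := fun a => f.symm (h.hom (aug a))
        map_add' := fun a b => by rw [aug_add, map_add, map_add]
        map_smul' := fun c a => by rw [aug_smul, map_smul h.hom, symm_smul]; simp }
    have hD : D ∈ skewDerivations χ ψ := fun a b => by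
      change f.symm (h.hom (aug (a * b))) = ψ a * f.symm (h.hom (aug b)) +
        f.symm (h.hom (aug a)) * χ b
      rw [aug_mul, map_add, map_add, map_smul h.hom, map_smul h.hom, symm_smul, symm_smul,
        AlgHom.commutes, mul_comm (f.symm (h.hom (aug a)))]
      rfl
    have hΦD : Φ ⟨D, hD⟩ = h := by
      ext x
      rw [hΦ]
      change f (f.symm (h.hom (aug x.1))) = _
      rw [aug_coe, f.apply_symm_apply]
    exact ⟨⟨D, hD⟩, by rw [LinearMap.comp_apply, LinearMap.comp_apply, hΦD]; rfl⟩
  · have h₀ : ((Abelian.Ext.precompOfLinear hS.extClass k N (add_zero 1)).comp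
        ((Abelian.Ext.linearEquiv₀ (R := k)).symm.toLinearMap.comp Φ)) D =
        hS.extClass.comp (Abelian.Ext.mk₀ (Φ D)) (add_zero 1) := rfl
    rw [h₀]
    constructor
    · intro h
      obtain ⟨y, hy⟩ := Abelian.Ext.contravariant_sequence_exact₁ hS N _ (add_zero 1) h
      obtain ⟨g, rfl⟩ := (Abelian.Ext.linearEquiv₀ (R := k)).symm.surjective y
      rw [Abelian.Ext.linearEquiv₀_symm_apply, Abelian.Ext.mk₀_comp_mk₀] at hy
      have hg : S.f ≫ g = Φ D := Abelian.Ext.mk₀_bijective _ _ |>.1 hy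
      -- The class vanishes exactly when the map on ker χ extends to A; an extension is determined
      -- by its value at 1, which gives the constant.
      refine ⟨f.symm (g.hom (1 : A)), LinearMap.ext fun a => f.injective ?_⟩
      have h₁ : f (D.1 (a - algebraMap k A (χ a))) = g.hom (a - algebraMap k A (χ a) : A) := by
        rw [← hΦ D ⟨_, sub_mem a⟩, ← hg]; rfl
      have h₂ : g.hom (a - algebraMap k A (χ a) : A) =
          (a - algebraMap k A (χ a)) • g.hom (1 : A) := by
        rw [← map_smul]; congr 1; exact (mul_one _).symm
      have h₃ : D.1 (algebraMap k A (χ a)) = 0 := by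
        rw [Algebra.algebraMap_eq_smul_one, map_smul, skewDerivations_map_one D.2, smul_zero]
      rw [h₂, map_sub, h₃, sub_zero, ← f.apply_symm_apply (g.hom (1 : A)), ← hf] at h₁
      rw [h₁]
      simp [mul_comm]
    · rintro ⟨c, hc⟩
      let g : S.X₂ ⟶ N := ModuleCat.ofHom
        { toFun := fun a : A => f (ψ a * c)
          map_add' := fun a b => by rw [map_add, add_mul, map_add]
          map_smul' := fun a b => by
            rw [smul_eq_mul, map_mul ψ, mul_assoc, hf]; rfl }
      have hg : Φ D = S.f ≫ g := by
        ext x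
        have hx : χ x.1 = 0 := by simpa [characterProjection] using x.2
        rw [hΦ, hc]
        change _ = f (ψ x.1 * c)
        simp [hx, mul_comm]
      rw [hg, ← Abelian.Ext.mk₀_comp_mk₀, hS.extClass_comp_assoc]

end CharacterExt

theorem affordsCharacter_of_smul_eq {k : Type v} [Field k] {A : Type w} [Ring A] [Algebra k A]
    {χ : A →ₐ[k] k} {M : ModuleCat.{w} A} [IsSimpleModule A M]
    (h : ∀ (a : A) (m : M), a • m = algebraMap k A (χ a) • m) : AffordsCharacter χ M := by
  have := IsSimpleModule.nontrivial A M
  obtain ⟨m, hm⟩ := exists_ne (0 : M)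
  let e : k →+ M :=
    { toFun := fun c => algebraMap k A c • m
      map_zero' := by simp
      map_add' := fun c d => by rw [map_add, add_smul] }
  have he (c : k) : e c = algebraMap k A c • m := rfl
  have hinj : Function.Injective e := by
    rw [injective_iff_map_eq_zero]
    intro c hc
    by_contra hc₀
    apply hm
    calc m = algebraMap k A c⁻¹ • e c := by
          rw [he, smul_smul, ← map_mul, inv_mul_cancel₀ hc₀, map_one, one_smul]
      _ = 0 := by rw [hc, smul_zero]
  have hsurj : Function.Surjective e := fun x => by
    obtain ⟨a, rfl⟩ := IsSimpleModule.toSpanSingleton_surjective A hm x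
    exact ⟨χ a, (h a m).symm⟩
  refine ⟨AddEquiv.ofBijective e ⟨hinj, hsurj⟩, fun a c => ?_⟩
  change e (χ a * c) = a • e c
  rw [h, he, he, smul_smul, map_mul]

/-! ### Linear forms and derivations on a monoid algebra. -/

theorem monoidAlgebra_linearMap_ext {k : Type v} [Field k] {S : Type u}
    {D E : MonoidAlgebra k S →ₗ[k] k}
    (h : ∀ s : S, D (MonoidAlgebra.single s 1) = E (MonoidAlgebra.single s 1)) : D = E := by
  ext s
  exact h s

/-- The linear form on `kS` with prescribed values on `S`. -/
def extendLinear {k : Type v} [Field k] {S : Type u} :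
    (S → k) →ₗ[k] MonoidAlgebra k S →ₗ[k] k where
  toFun f := Finsupp.linearCombination k f ∘ₗ (MonoidAlgebra.coeffLinearEquiv k).toLinearMap
  map_add' f g := by ext; simp
  map_smul' c f := by ext; simp

theorem extendLinear_single {k : Type v} [Field k] {S : Type u} (f : S → k) (s : S) :
    extendLinear f (MonoidAlgebra.single s 1) = f s := by
  simp [extendLinear]

theorem mem_skewDerivations_iff {k : Type v} [Field k] {S : Type u} [Monoid S]
    {χ ψ : MonoidAlgebra k S →ₐ[k] k} {D : MonoidAlgebra k S →ₗ[k] k} :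
    D ∈ skewDerivations χ ψ ↔ ∀ s t : S, D (MonoidAlgebra.single (s * t) 1) =
      ψ (MonoidAlgebra.single s 1) * D (MonoidAlgebra.single t 1) +
        D (MonoidAlgebra.single s 1) * χ (MonoidAlgebra.single t 1) := by
  constructor
  · intro h s t
    have := h (MonoidAlgebra.single s 1) (MonoidAlgebra.single t 1)
    rwa [MonoidAlgebra.single_mul_single, one_mul] at this
  intro h a b
  induction a using MonoidAlgebra.induction_on with
  | of s =>
    induction b using MonoidAlgebra.induction_on with
    | of t => simpa [MonoidAlgebra.single_mul_single] using h s t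
    | add b c hb hc => rw [mul_add, map_add, hb, hc, map_add, map_add]; ring
    | smul r b hb => rw [mul_smul_comm, map_smul, hb, map_smul, map_smul]; simp; ring
  | add a c ha hc => rw [add_mul, map_add, ha, hc, map_add, map_add]; ring
  | smul r a ha => rw [smul_mul_assoc, map_smul, ha, map_smul, map_smul]; simp; ring

namespace LeftRegularBand

/-! ### The simple modules of kS. -/

section Characters

variable {k : Type v} [Field k] {S : Type u} [Monoid S] [LeftRegularBand S]

open Classical in
theorem character_single (X : SupportLattice S) (s : S) (c : k) :
    character k X (MonoidAlgebra.single s c) = if supp s ≤ X then c else 0 := by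
  simp [character, MonoidAlgebra.lift_single]

theorem character_injective :
    Function.Injective (character k : SupportLattice S → MonoidAlgebra k S →ₐ[k] k) := by
  have key (X Y : SupportLattice S) (h : character k X = character k Y) : X ≤ Y := by
    obtain ⟨x, rfl⟩ := supp_surjective X
    by_contra hxy
    have := congr($h (MonoidAlgebra.single x 1))
    simp [character_single, hxy] at this
  exact fun X Y h => le_antisymm (key X Y h) (key Y X h.symm)

theorem affordsCharacter_charModule (X : SupportLattice S) :
    AffordsCharacter (character k X) (charModule k X) :=
  ⟨AddEquiv.ulift.symm, fun _ _ => rfl⟩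

/-- Every simple module affords one of the characters `χ_X`. -/
theorem exists_affordsCharacter [Finite S] (M : ModuleCat.{max u v} (MonoidAlgebra k S))
    [Simple M] : ∃ X : SupportLattice S, AffordsCharacter (character k X) M := by
  have : Nontrivial M := IsSimpleModule.nontrivial (MonoidAlgebra k S) M
  obtain ⟨m₀, hm₀⟩ := exists_ne (0 : M)
  obtain ⟨s, ⟨m, hm⟩, hs⟩ := Set.Finite.exists_maximalFor (supp (S := S))
    {s | ∃ m : M, MonoidAlgebra.single s (1 : k) • m ≠ 0} (Set.toFinite _)
    ⟨1, m₀, by rwa [← MonoidAlgebra.one_def, one_smul]⟩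
  refine ⟨supp s, affordsCharacter_of_smul_eq ?_⟩
  -- If supp t ≤ supp s then st = s; otherwise st has strictly larger support and annihilates M by
  -- maximality.
  have hst (t : S) (n : M) : MonoidAlgebra.single s (1 : k) • MonoidAlgebra.single t (1 : k) • n =
      algebraMap k (MonoidAlgebra k S) (character k (supp s) (MonoidAlgebra.single t 1)) •
        MonoidAlgebra.single s (1 : k) • n := by
    rw [smul_smul, MonoidAlgebra.single_mul_single, mul_one, character_single]
    split_ifs with ht
    · rw [supp_le_supp.1 ht, map_one, one_smul]
    · rw [map_zero, zero_smul]
      by_contra h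
      exact ht ((supp_mul_le.1 (hs ⟨n, h⟩ (supp_mul_le.1 le_rfl).1)).2)
  have hsa (a : MonoidAlgebra k S) (n : M) : MonoidAlgebra.single s (1 : k) • a • n =
      algebraMap k (MonoidAlgebra k S) (character k (supp s) a) •
        MonoidAlgebra.single s (1 : k) • n := by
    induction a using MonoidAlgebra.induction_on with
    | of t => exact hst t n
    | add a b ha hb => rw [add_smul, smul_add, ha, hb, map_add, map_add, add_smul]
    | smul r a ha =>
      rw [Algebra.smul_def, map_mul, AlgHom.commutes, map_mul, mul_smul, mul_smul, ← ha,
        smul_smul, ← Algebra.commutes, mul_smul]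
      rfl
  -- By `hsa` the kernel of s is a submodule, hence zero, so the relation `hsa` can be cancelled by
  -- s.
  let K : Submodule (MonoidAlgebra k S) M :=
    { carrier := {n | MonoidAlgebra.single s (1 : k) • n = 0}
      zero_mem' := smul_zero _
      add_mem' := fun {a b} ha hb => by
        change _ • (a + b) = (0 : M)
        rw [smul_add, show _ • a = (0 : M) from ha, show _ • b = (0 : M) from hb, add_zero]
      smul_mem' := fun a n hn => by
        change _ • _ • n = (0 : M)
        rw [hsa, show _ • n = (0 : M) from hn, smul_zero] }
  have hK : K = ⊥ := (eq_bot_or_eq_top K).resolve_right fun h =>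
    hm (show m ∈ K by rw [h]; trivial)
  intro a n
  rw [← sub_eq_zero, ← Submodule.mem_bot (MonoidAlgebra k S), ← hK]
  change _ • _ = (0 : M)
  rw [smul_sub, hsa, smul_smul _ _ n, smul_smul _ _ n, Algebra.commutes, sub_self]

end Characters

/-! ### Derivations for a pair of characters χ_X, χ_Y. -/

section Derivations

variable {k : Type v} [Field k] {S : Type u} [Monoid S] [LeftRegularBand S]

variable {X Y : SupportLattice S} {D : MonoidAlgebra k S →ₗ[k] k}

theorem skewDerivation_single_mul (hD : D ∈ skewDerivations (character k X) (character k Y))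
    (s t : S) [Decidable (supp s ≤ Y)] [Decidable (supp t ≤ X)] :
    D (MonoidAlgebra.single (s * t) 1) =
      (if supp s ≤ Y then D (MonoidAlgebra.single t 1) else 0) +
        if supp t ≤ X then D (MonoidAlgebra.single s 1) else 0 := by
  rw [mem_skewDerivations_iff.1 hD, character_single, character_single]
  split_ifs <;> simp

/-- Since s² = s, the derivation rule reads D(s) = 2D(s) or D(s) = 0; either way D(s) = 0 in every
characteristic. -/
theorem skewDerivation_eq_zero (hD : D ∈ skewDerivations (character k X) (character k Y))
    {s : S} (hs : supp s ≤ X ↔ supp s ≤ Y) : D (MonoidAlgebra.single s 1) = 0 := by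
  classical
  have := skewDerivation_single_mul hD s s
  rw [mul_self] at this
  by_cases h : supp s ≤ Y
  · simpa [h, hs.2 h] using this
  · simpa [h, mt hs.1 h] using this

theorem skewDerivation_inner_of_not_le
    (hD : D ∈ skewDerivations (character k X) (character k Y)) (hXY : ¬ Y ≤ X) :
    ∃ c : k, D = c • ((character k Y).toLinearMap - (character k X).toLinearMap) := by
  classical
  obtain ⟨y, rfl⟩ := supp_surjective Y
  -- The rule gives D(st) = D(t) and D(sts) = D(s), while sts = st.
  have hconst {s t : S} (hs : supp s ≤ supp y) (hs' : ¬ supp s ≤ X) (ht : supp t ≤ supp y)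
      (ht' : ¬ supp t ≤ X) : D (MonoidAlgebra.single s 1) = D (MonoidAlgebra.single t 1) := by
    have hst : supp (s * t) ≤ supp y := supp_mul_le.2 ⟨hs, ht⟩
    have h₁ := skewDerivation_single_mul hD s t
    have h₂ := skewDerivation_single_mul hD (s * t) s
    rw [mul_mul_left] at h₂
    simp only [hs, ht', hst, hs', if_true, if_false, add_zero] at h₁ h₂
    rw [← h₁, h₂]
  refine ⟨D (MonoidAlgebra.single y 1), monoidAlgebra_linearMap_ext fun s => ?_⟩
  rw [LinearMap.smul_apply, LinearMap.sub_apply, AlgHom.toLinearMap_apply,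
    AlgHom.toLinearMap_apply, character_single, character_single]
  by_cases h₁ : supp s ≤ supp y <;> by_cases h₂ : supp s ≤ X
  · simp [h₁, h₂, skewDerivation_eq_zero hD (iff_of_true h₂ h₁)]
  · simp [h₁, h₂, hconst h₁ h₂ le_rfl hXY]
  -- The support of ys lies below neither X nor Y, so 0 = D(ys) = D(s) + D(y).
  · have h₃ : ¬ supp (y * s) ≤ X := fun h => hXY (supp_mul_le.1 h).1
    have h₄ : ¬ supp (y * s) ≤ supp y := fun h => h₁ (supp_mul_le.1 h).2
    have h₅ := skewDerivation_single_mul hD y s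
    rw [skewDerivation_eq_zero hD (iff_of_false h₃ h₄)] at h₅
    simp only [le_refl, h₂, if_true] at h₅
    simp [h₁, h₂, eq_neg_of_add_eq_zero_left h₅.symm]
  · simp [h₁, h₂, skewDerivation_eq_zero hD (iff_of_false h₂ h₁)]

theorem skewDerivation_self (hD : D ∈ skewDerivations (character k X) (character k X)) : D = 0 :=
  monoidAlgebra_linearMap_ext fun _ => skewDerivation_eq_zero hD Iff.rfl

end Derivations

end LeftRegularBand

namespace LeftRegularBand

/-! ### Left multiplication and the relation ⌣. -/

section Smile

variable {S : Type u} [Semigroup S] [LeftRegularBand S]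

theorem supp_mul_eq {X : SupportLattice S} {s x : S} (hs : supp s ≤ X) (hx : supp x = X) :
    supp (s * x) = X :=
  le_antisymm (supp_mul_le.2 ⟨hs, hx.le⟩) (hx.ge.trans (supp_mul_le.1 le_rfl).2)

/-- Left multiplication of the elements of support `X` by an element of smaller support. -/
def leftMul {X : SupportLattice S} (s : S) (hs : supp s ≤ X) (x : {x : S // supp x = X}) :
    {x : S // supp x = X} :=
  ⟨s * x.1, supp_mul_eq hs x.2⟩

/-- The witness is w = yt. It differs from y because supp t ≰ supp y. If it equalled ytx or ytx', it
would have support X and so absorb both x and x', making ytx = ytx'. -/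
theorem smile_leftMul {X : SupportLattice S} {y t : S} (hy : supp y ≤ X) (ht : supp t ≤ X)
    (hty : ¬ supp t ≤ supp y) (x x' : {x : S // supp x = X}) :
    Smile y X (leftMul t ht x) (leftMul t ht x') := by
  have key (z z' : {x : S // supp x = X}) (h : y * t = y * (t * z.1)) :
      y * (t * z.1) = y * (t * z'.1) := by
    have hz : supp (y * t) = X := by
      rw [h, ← mul_assoc]
      exact supp_mul_eq (supp_mul_le.2 ⟨hy, ht⟩) z.2
    rw [← h, ← mul_assoc]
    exact (supp_le_supp.1 (z'.2.trans hz.symm).le).symm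
  by_cases h : y * (t * x.1) = y * (t * x'.1)
  · exact Or.inl h
  · refine Or.inr ⟨y * t, ⟨by rw [← mul_assoc, mul_self], fun e => hty ?_⟩,
      ⟨?_, fun e => h (key x x' e)⟩, ⟨?_, fun e => h (key x' x e).symm⟩⟩
    · exact supp_le_supp.2 e.symm
    all_goals
      change y * t * (y * (t * _)) = y * (t * _)
      rw [← mul_assoc, ← mul_assoc, mul_mul_left, mul_assoc y t t, mul_self, mul_assoc]

theorem smile_leftMul_of_le {X : SupportLattice S} {y s : S} (hs : supp s ≤ X)
    (hsy : supp s ≤ supp y) (x : {x : S // supp x = X}) :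
    Smile y X (leftMul s hs x) x :=
  Or.inl (by change y * (s * x.1) = y * x.1; rw [← mul_assoc, supp_le_supp.1 hsy])

/-- A function that is constant along `⌣` is constant on the `∼`-classes. -/
theorem eq_of_smileSetoid {α : Type*} {X : SupportLattice S} {y : S}
    {f : {x : S // supp x = X} → α} (hf : ∀ x x', Smile y X x x' → f x = f x')
    {x x' : {x : S // supp x = X}} (h : (smileSetoid y X).r x x') : f x = f x' := by
  induction h with
  | single h => exact hf _ _ h
  | tail _ h ih => exact ih.trans (hf _ _ h)

end Smile

section ArrowNumber

variable {S : Type u} [Semigroup S] [LeftRegularBand S]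

theorem arrowNumber_self (y : S) : arrowNumber (supp y) y = 0 := by
  have : Subsingleton (Quotient (smileSetoid y (supp y))) := by
    refine ⟨fun a b => ?_⟩
    induction a, b using Quotient.inductionOn₂ with
    | h a b =>
      refine Quotient.sound (Relation.TransGen.single (Or.inl ?_))
      rw [supp_le_supp.1 a.2.le, supp_le_supp.1 b.2.le]
  rw [arrowNumber, if_pos le_rfl]
  have := Finite.card_le_one_iff_subsingleton (α := Quotient (smileSetoid y (supp y))) |>.2 this
  omega

theorem arrowNumber_of_not_le {X : SupportLattice S} {y : S} (h : ¬ supp y ≤ X) :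
    arrowNumber X y = 0 := if_neg h

end ArrowNumber

/-! ### Derivations for Y < X as functions on the ∼-classes. -/

section Derivations

variable {k : Type v} [Field k] {S : Type u} [Monoid S] [LeftRegularBand S]
  {X : SupportLattice S} {y : S}

open Classical in
/-- The function on `S` that sends `s` to the value of `g` on the class of `s * x` if
`supp s ≤ X` and `supp s ≰ supp y`, and to `0` otherwise. -/
def classFunction (x : {x : S // supp x = X}) :
    (Quotient (smileSetoid y X) → k) →ₗ[k] S → k where
  toFun g s := if h : supp s ≤ X ∧ ¬ supp s ≤ supp y then
    g (Quotient.mk _ (leftMul s h.1 x)) else 0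
  map_add' f g := by ext s; by_cases h : supp s ≤ X ∧ ¬ supp s ≤ supp y <;> simp [h]
  map_smul' c f := by ext s; by_cases h : supp s ≤ X ∧ ¬ supp s ≤ supp y <;> simp [h]

theorem classFunction_of_mem (x : {x : S // supp x = X}) (g : Quotient (smileSetoid y X) → k)
    {s : S} (h : supp s ≤ X) (h' : ¬ supp s ≤ supp y) :
    classFunction x g s = g (Quotient.mk _ (leftMul s h x)) := dif_pos ⟨h, h'⟩

theorem classFunction_of_notMem (x : {x : S // supp x = X})
    (g : Quotient (smileSetoid y X) → k) {s : S} (h : ¬ (supp s ≤ X ∧ ¬ supp s ≤ supp y)) :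
    classFunction x g s = 0 := dif_neg h

theorem classFunction_mem_skewDerivations (hy : supp y ≤ X) (x : {x : S // supp x = X})
    (g : Quotient (smileSetoid y X) → k) :
    extendLinear (classFunction x g) ∈
      skewDerivations (character k X) (character k (supp y)) := by
  classical
  refine mem_skewDerivations_iff.2 fun s t => ?_
  rw [extendLinear_single, extendLinear_single, extendLinear_single, character_single,
    character_single]
  by_cases ht : supp t ≤ X
  · by_cases hs : supp s ≤ supp y
    · have hsX := hs.trans hy
      rw [if_pos hs, if_pos ht, classFunction_of_notMem (s := s) x g (fun h => h.2 hs), one_mul,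
        zero_mul, add_zero]
      by_cases ht' : supp t ≤ supp y
      · rw [classFunction_of_notMem x g (fun h => h.2 ht'),
          classFunction_of_notMem x g (fun h => h.2 (supp_mul_le.2 ⟨hs, ht'⟩))]
      · rw [classFunction_of_mem x g ht ht', classFunction_of_mem x g (supp_mul_le.2 ⟨hsX, ht⟩)
          fun h => ht' (supp_mul_le.1 h).2]
        -- Here D(st) = D(t) is required, and stx ⌣ tx because ys = y.
        refine congrArg g (Quotient.sound (.single ?_))
        convert smile_leftMul_of_le hsX hs (leftMul t ht x) using 1
        exact Subtype.ext (mul_assoc _ _ _)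
    · rw [if_neg hs, if_pos ht, zero_mul, zero_add, mul_one]
      by_cases hsX : supp s ≤ X
      · rw [classFunction_of_mem x g hsX hs, classFunction_of_mem x g (supp_mul_le.2 ⟨hsX, ht⟩)
          fun h => hs (supp_mul_le.1 h).1]
        -- Here D(st) = D(s) is required: the class of sx does not depend on the choice of x in S_X.
        refine congrArg g (Quotient.sound (.single ?_))
        convert smile_leftMul hy hsX hs (leftMul t ht x) x using 1
        exact Subtype.ext (mul_assoc _ _ _)
      · rw [classFunction_of_notMem x g fun h => hsX h.1,
          classFunction_of_notMem x g fun h => hsX (supp_mul_le.1 h.1).1]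
  · rw [if_neg ht, mul_zero, add_zero, classFunction_of_notMem (s := t) x g fun h => ht h.1,
      mul_zero, classFunction_of_notMem x g fun h => ht (supp_mul_le.1 h.1).2]

/-- The derivation with prescribed values on the `∼`-classes. -/
def classDerivation (hy : supp y ≤ X) (x : {x : S // supp x = X}) :
    (Quotient (smileSetoid y X) → k) →ₗ[k]
      skewDerivations (character k X) (character k (supp y)) :=
  (extendLinear ∘ₗ classFunction x).codRestrict _ (classFunction_mem_skewDerivations hy x)

theorem classDerivation_single (hy : supp y ≤ X) (x : {x : S // supp x = X})
    (g : Quotient (smileSetoid y X) → k) (s : S) :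
    (classDerivation hy x g).1 (MonoidAlgebra.single s 1) = classFunction x g s :=
  extendLinear_single _ s

/-- D(yz) = D(z) since D(y) = 0; and if w lies between y and yz, then D(yz) = D(w · yz) = D(w),
which does not involve z. -/
theorem skewDerivation_eq_of_smile {D : MonoidAlgebra k S →ₗ[k] k}
    (hD : D ∈ skewDerivations (character k X) (character k (supp y))) (hy : supp y < X)
    {x x' : {x : S // supp x = X}} (h : Smile y X x x') :
    D (MonoidAlgebra.single x.1 1) = D (MonoidAlgebra.single x'.1 1) := by
  classical
  have h_left (z : {x : S // supp x = X}) :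
      D (MonoidAlgebra.single (y * z.1) 1) = D (MonoidAlgebra.single z.1 1) := by
    rw [skewDerivation_single_mul hD, if_pos le_rfl, if_pos z.2.le,
      skewDerivation_eq_zero hD (iff_of_true hy.le le_rfl), add_zero]
  rw [← h_left x, ← h_left x']
  obtain h | ⟨w, hw, hx, hx'⟩ := h
  · rw [h]
  · have hwy : ¬ supp w ≤ supp y := fun h => hw.2 ((supp_le_supp.1 h).symm.trans hw.1)
    have h_right {z : S} (hz : supp z = X) (e : w * (y * z) = y * z) :
        D (MonoidAlgebra.single (y * z) 1) = D (MonoidAlgebra.single w 1) := by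
      rw [← e, skewDerivation_single_mul hD, if_neg hwy, if_pos (supp_mul_eq hy.le hz).le,
        zero_add]
    rw [h_right x.2 hx.1, h_right x'.2 hx'.1]

theorem classDerivation_surjective (hy : supp y < X) (x : {x : S // supp x = X}) :
    Function.Surjective (classDerivation (k := k) hy.le x) := by
  classical
  rintro ⟨D, hD⟩
  refine ⟨Quotient.lift (fun z => D (MonoidAlgebra.single z.1 1)) fun _ _ h =>
    eq_of_smileSetoid (f := fun z => D (MonoidAlgebra.single z.1 1))
      (fun _ _ => skewDerivation_eq_of_smile hD hy) h, Subtype.ext ?_⟩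
  refine monoidAlgebra_linearMap_ext fun s => ?_
  rw [classDerivation_single]
  by_cases hs : supp s ≤ X
  · by_cases hs' : supp s ≤ supp y
    · rw [classFunction_of_notMem _ _ fun h => h.2 hs',
        skewDerivation_eq_zero hD (iff_of_true hs hs')]
    · rw [classFunction_of_mem x _ hs hs']
      change D (MonoidAlgebra.single (s * x.1) 1) = _
      rw [skewDerivation_single_mul hD, if_neg hs', if_pos x.2.le, zero_add]
  · rw [classFunction_of_notMem _ _ fun h => hs h.1,
      skewDerivation_eq_zero hD (iff_of_false hs fun h => hs (h.trans hy.le))]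

theorem classDerivation_inner_iff (hy : supp y < X) (x : {x : S // supp x = X})
    (g : Quotient (smileSetoid y X) → k) :
    (∃ c : k, (classDerivation hy.le x g).1 =
      c • ((character k (supp y)).toLinearMap - (character k X).toLinearMap)) ↔
    g ∈ Submodule.span k {(1 : Quotient (smileSetoid y X) → k)} := by
  classical
  rw [Submodule.mem_span_singleton]
  constructor
  · rintro ⟨c, hc⟩
    -- The sign appears because χ_Y - χ_X takes the value -1 on S_X.
    refine ⟨-c, funext fun q => ?_⟩
    induction q using Quotient.inductionOn with
    | h z =>
      have h₁ : ¬ supp z.1 ≤ supp y := fun h => hy.not_ge (z.2.ge.trans h)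
      have h₂ := congr($hc (MonoidAlgebra.single z.1 1))
      have h₃ : leftMul z.1 z.2.le x = z :=
        Subtype.ext (supp_le_supp.1 (x.2.trans z.2.symm).le)
      rw [classDerivation_single, classFunction_of_mem x g z.2.le h₁, h₃] at h₂
      rw [h₂]
      simp [character_single, h₁, z.2.le]
  · rintro ⟨c, rfl⟩
    refine ⟨-c, monoidAlgebra_linearMap_ext fun s => ?_⟩
    rw [classDerivation_single, LinearMap.smul_apply, LinearMap.sub_apply,
      AlgHom.toLinearMap_apply, AlgHom.toLinearMap_apply, character_single, character_single]
    by_cases hs : supp s ≤ X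
    · by_cases hs' : supp s ≤ supp y
      · rw [classFunction_of_notMem _ _ fun h => h.2 hs']
        simp [hs, hs']
      · rw [classFunction_of_mem x _ hs hs']
        simp [hs, hs']
    · rw [classFunction_of_notMem _ _ fun h => hs h.1]
      have hs' : ¬ supp s ≤ supp y := fun h => hs (h.trans hy.le)
      simp [hs, hs']

end Derivations

/-! ### Dimension count. -/

section Main

variable {k : Type v} [Field k] {S : Type u} [Monoid S] [LeftRegularBand S] [Finite S]
  {X : SupportLattice S} {y : S}

/-- Stated for all modules affording the characters, because the chosen representative of a vertex
is only isomorphic to M_X. -/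
theorem rank_ext_of_affordsCharacter {M N : ModuleCat.{max u v} (MonoidAlgebra k S)}
    (hM : AffordsCharacter (character k X) M) (hN : AffordsCharacter (character k (supp y)) N) :
    Module.rank k (Abelian.Ext M N 1) = arrowNumber X y := by
  obtain ⟨Θ, hΘ, hker⟩ := exists_skewDerivations_surjection hM hN
  by_cases hy : supp y < X
  · obtain ⟨x, hx⟩ := supp_surjective X
    let Ψ := Θ ∘ₗ classDerivation hy.le ⟨x, hx⟩
    have hΨ : Function.Surjective Ψ := hΘ.comp (classDerivation_surjective hy ⟨x, hx⟩)
    have hΨker : LinearMap.ker Ψ = Submodule.span k {1} := by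
      ext g
      rw [← classDerivation_inner_iff hy ⟨x, hx⟩ g, ← hker]
      rfl
    have : Nonempty (Quotient (smileSetoid y X)) := ⟨Quotient.mk _ ⟨x, hx⟩⟩
    have := Fintype.ofFinite (Quotient (smileSetoid y X))
    have := Module.Finite.of_surjective Ψ hΨ
    have h₁ := Ψ.finrank_range_add_finrank_ker
    rw [hΨker, finrank_span_singleton one_ne_zero, LinearMap.range_eq_top.2 hΨ, finrank_top,
      Module.finrank_fintype_fun_eq_card] at h₁
    rw [← Module.finrank_eq_rank, arrowNumber, if_pos hy.le, Nat.card_eq_fintype_card, ← h₁]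
    simp
  · have h₀ : arrowNumber X y = 0 := by
      obtain h | h := eq_or_ne (supp y) X
      · rw [← h, arrowNumber_self]
      · exact arrowNumber_of_not_le fun h' => hy (lt_of_le_of_ne h' h)
    have : Subsingleton (Abelian.Ext M N 1) := by
      refine subsingleton_of_forall_eq 0 fun z => ?_
      obtain ⟨D, rfl⟩ := hΘ z
      rw [hker]
      by_cases h : supp y ≤ X
      · obtain rfl : supp y = X := by_contra fun h' => hy (lt_of_le_of_ne h h')
        exact ⟨0, by rw [skewDerivation_self D.2, zero_smul]⟩
      · exact skewDerivation_inner_of_not_le D.2 h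
    rw [h₀, rank_subsingleton', Nat.cast_zero]

end Main

end LeftRegularBand
end

theorem mainTheorem1 {S : Type u} [Monoid S] [LeftRegularBand S] [Finite S]
    (k : Type v) [Field k] :
    (∃ e : LeftRegularBand.SupportLattice S ≃ ExtQuiver k (MonoidAlgebra k S),
      (∀ X : LeftRegularBand.SupportLattice S,
        Nonempty ((e X).rep ≅ LeftRegularBand.charModule k X)) ∧
      ∀ (X Y : LeftRegularBand.SupportLattice S) (y : S), LeftRegularBand.supp y = Y →
        Nonempty ((e X ⟶ e Y) ≃ Fin (LeftRegularBand.arrowNumber X y))) ∧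
    ∀ (X Y : LeftRegularBand.SupportLattice S) (y : S), LeftRegularBand.supp y = Y →
      Module.rank k (Abelian.Ext (LeftRegularBand.charModule k X)
        (LeftRegularBand.charModule k Y) 1) = LeftRegularBand.arrowNumber X y := by
  have hchar (X : LeftRegularBand.SupportLattice S) :=
    LeftRegularBand.affordsCharacter_charModule (k := k) X
  let φ (X : LeftRegularBand.SupportLattice S) : ExtQuiver k (MonoidAlgebra k S) :=
    Quotient.mk _ ⟨LeftRegularBand.charModule k X, (hchar X).simple⟩
  have hφ : Function.Bijective φ := by
    refine ⟨fun X Y h => ?_, fun V => ?_⟩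
    · obtain ⟨i⟩ : Nonempty (LeftRegularBand.charModule k X ≅ LeftRegularBand.charModule k Y) :=
        Quotient.exact h
      exact LeftRegularBand.character_injective (((hchar X).of_iso i).character_eq (hchar Y))
    · induction V using Quotient.inductionOn with
      | h M =>
        have := M.2
        obtain ⟨X, hX⟩ := LeftRegularBand.exists_affordsCharacter M.1
        exact ⟨X, Quotient.sound ((hchar X).nonempty_iso hX)⟩
  have hrep (X : LeftRegularBand.SupportLattice S) :
      Nonempty ((φ X).rep ≅ LeftRegularBand.charModule k X) :=
    Quotient.exact (Quotient.out_eq (s := simpleModuleSetoid _) (φ X))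
  have hrep' (X : LeftRegularBand.SupportLattice S) :
      AffordsCharacter (LeftRegularBand.character k X) (φ X).rep :=
    (hrep X).elim fun i => (hchar X).of_iso i.symm
  refine ⟨⟨Equiv.ofBijective φ hφ, hrep, ?_⟩, ?_⟩
  · rintro X _ y rfl
    have h := LeftRegularBand.rank_ext_of_affordsCharacter (hrep' X)
      (hrep' (LeftRegularBand.supp y))
    -- The arrows index a basis, so their cardinality is the rank just computed.
    rw [← (Module.Basis.ofVectorSpace k _).mk_eq_rank''] at h
    exact Cardinal.mk_eq_nat_iff.1 h
  · rintro X _ y rfl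
    exact LeftRegularBand.rank_ext_of_affordsCharacter (hchar X) (hchar _)
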